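/- **Conventions.** Let $X$ be a set with an extended metric $d$ with a point at infinity $*_X$: $d(x,*_X)=\infty$ for all $x\neq *_X$, $d(*_X,*_X)=0$, and $d$ restricted to the set of finite points $X\setminus\{*_X\}$ is a metric, which is assumed to be unbounded. The topology of $X$ is generated by the balls $B(x,r)$ and the sets $\{y : d(x,y)>r\}\ni *_X$ ($x$ finite, $0<r<\infty$). Fix a finite point $o\in X$ (the origin) and write $|x|=d(o,x)$. The same conventions are used for $(Y,o',*_Y)$. - An *admissible gauge* is a nondecreasing function $u:[0,\infty)\to\mathbb R$ with $\limsup_{r\to\infty}u(r)/r=0$. Finite points $x,y$ are *separated by $u$* if $d(x,y)>u(|x|+|y|)$; every finite point is separated from $*_X$. - For $x\ne w$, $y\neq z$ the *cross ratio* is $[x,y,z,w]=\frac{d(x,z)\,d(y,w)}{d(x,w)\,d(y,z)}$, where factors containing the point at infinity are omitted; it is $0$ if $x=z$ or $y=w$. For image points, the value is $\infty$ if $x=w$ or $y=z$, unless $x=z$ or $y=w$ (in which case it is $0$). - A map $f:X\to Y$ with $f(o)=o'$ and $f(*_X)=*_Y$ is an *AM-map* (asymptotic-Möbius map at infinity)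 if there are an admissible gauge $u$ and a homeomorphism $\eta:[0,\infty)\to[0,\infty)$ such that $[f(x),f(y),f(z),f(w)]<\eta([x,y,z,w])$ for all $x,y,z,w\in X$ that are pairwise separated by $u$ (and with $x\neq w$, $y\ne z$). It is *regular* if it is continuous at $*_X$ and for every neighbourhood $V$ of $*_X$ there is a neighbourhood $U$ of $*_Y$ with $f^{-1}(U)\subset V$. - $(X,o,*_X)$ is *asymptotically chained* if there is an admissible gauge $v$ such that any two finite points $x,y$ are joined by a finite chain $x=x_1,\dots,x_{k+1}=y$ of finite points with $d(x_i,x_{i+1})<v(|x|+|y|)$ for all $i$. - For a finite point $q\in X$, a nonprincipal ultrafilter $\omega$ on $\mathbb N$ and reals $\lambda_n$ with $\lim_\omega\lambda_n=\infty$, the *asymptotic cone* $\operatorname{Cone}^\omega_{\lambda_n}(X,q)$ is the metric space (of finite points) consisting of the sequences $(x_n)$ of finite points of $X$ with $\lim_\omega d(q,x_n)/\lambda_n<\infty$, with the distance $\lim_\omega d(x_n,y_n)/\lambda_n$, where sequences at distance $0$ are identified. - The *covering dimension* of a space is the least $n\in\mathbb N$ such that every finite open cover has an open refinement that is a cover and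 in which every point lies in at most $n+1$ members ($\infty$ if there is no such $n$). The *geometric dimension* of a metric space is the supremum of the covering dimensions of its compact subsets. If all asymptotic cones of $X$ are $\operatorname{CAT}(0)$-spaces, the *telescopic dimension* $\operatorname{tele-dim}(X)\in\mathbb N\cup\{\infty\}$ is the supremum of the geometric dimensions of all asymptotic cones of $X$. **Theorem.** Let $X$ and $Y$ be extended metric spaces with points at infinity $*_X$ and $*_Y$, and let $o\in X$, $o'\in Y$ be finite points. Suppose that $(X,o,*_X)$ is asymptotically chained and that all asymptotic cones of $X$ and of $Y$ are $\operatorname{CAT}(0)$-spaces. If there exists a regular AM-map $f:(X,o,*_X)\to(Y,o',*_Y)$, then $$\operatorname{tele-dim}(X)\le\operatorname{tele-dim}(Y).$$ -/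

import Mathlib

open Filter Topology Set
open scoped NNReal ENNReal

universe u v

/-! ### Extended metric spaces with a point at infinity -/

/-- A set `X` with an extended metric that has a point at infinity `infPt`: all other points are
at distance `∞` from it, and the distance restricted to the other (finite) points is a metric.
As usual for spaces with a point at infinity, the metric space of finite points is unbounded. -/
class ExtendedMetricSpace (X : Type u) where
  xdist : X → X → ℝ≥0∞
  infPt : X
  xdist_self : ∀ x, xdist x x = 0
  xdist_comm : ∀ x y, xdist x y = xdist y x
  xdist_infPt : ∀ x, x ≠ infPt → xdist x infPt = ∞
  xdist_ne_top : ∀ x y, x ≠ infPt → y ≠ infPt → xdist x y ≠ ∞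
  eq_of_xdist_eq_zero : ∀ x y, x ≠ infPt → y ≠ infPt → xdist x y = 0 → x = y
  xdist_triangle : ∀ x y z, x ≠ infPt → y ≠ infPt → z ≠ infPt →
    xdist x z ≤ xdist x y + xdist y z
  unbounded : ∀ x, x ≠ infPt → ∀ R : ℝ≥0, ∃ y, y ≠ infPt ∧ (R : ℝ≥0∞) < xdist x y

open ExtendedMetricSpace

/-- The finite points of an extended metric space. -/
def FinPt (X : Type u) [ExtendedMetricSpace X] : Type u := {x : X // x ≠ infPt}

/-- The metric on the finite points. -/
noncomputable instance FinPt.metricSpace (X : Type u) [ExtendedMetricSpace X] :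
    MetricSpace (FinPt X) where
  dist x y := (xdist x.1 y.1).toReal
  dist_self x := by simp [xdist_self]
  dist_comm x y := by rw [xdist_comm]
  dist_triangle x y z := by
    rw [← ENNReal.toReal_add (xdist_ne_top _ _ x.2 y.2) (xdist_ne_top _ _ y.2 z.2)]
    exact ENNReal.toReal_mono
      (ENNReal.add_ne_top.2 ⟨xdist_ne_top _ _ x.2 y.2, xdist_ne_top _ _ y.2 z.2⟩)
      (xdist_triangle _ _ _ x.2 y.2 z.2)
  eq_of_dist_eq_zero {x y} h := by
    rcases (ENNReal.toReal_eq_zero_iff _).1 h with h | h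
    · exact Subtype.ext (eq_of_xdist_eq_zero _ _ x.2 y.2 h)
    · exact absurd h (xdist_ne_top _ _ x.2 y.2)

/-- The extended metric topology: it is generated by the open balls `B(x, r)` and by the complements
`U(x, r)` (which contain the point at infinity) of closed balls, for finite `x` and `r > 0`. -/
abbrev extendedMetricTopology (X : Type u) [ExtendedMetricSpace X] : TopologicalSpace X :=
  TopologicalSpace.generateFrom
    ({s | ∃ (x : FinPt X) (r : ℝ≥0), 0 < r ∧ s = {y | xdist x.1 y < r}} ∪
     {s | ∃ (x : FinPt X) (r : ℝ≥0), 0 < r ∧ s = {y | (r : ℝ≥0∞) < xdist x.1 y}})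

section CrossRatio

variable {X : Type u} [ExtendedMetricSpace X]

open Classical in
/-- The factor `d(x, y)` of a cross ratio; it is omitted if it contains the point at infinity. -/
noncomputable def crossFactor (x y : X) : ℝ≥0∞ :=
  if x = infPt ∨ y = infPt then 1 else xdist x y

open Classical in
/-- The cross ratio `[x, y, z, w] = d(x, z) d(y, w) / (d(x, w) d(y, z))`, with values in `[0, ∞]`.
It is a number in `[0, ∞)` if `x ≠ w` and `y ≠ z`; it is `0` if `x = z` or `y = w`, and otherwise
it is `∞` if `x = w` or `y = z`. -/
noncomputable def crossRatio (x y z w : X) : ℝ≥0∞ :=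
  if x = z ∨ y = w then 0
  else if x = w ∨ y = z then ∞
  else (crossFactor x z * crossFactor y w) / (crossFactor x w * crossFactor y z)

end CrossRatio

/-! ### Gauges, AM-maps, asymptotic chains -/

/-- Admissible gauges: nondecreasing functions of sublinear growth. (A nondecreasing function on
`[0, ∞)` is bounded below, so `limsup u(r)/r = 0` says that `u(r)/r` tends to `0`.) -/
structure IsAdmissibleGauge (u : ℝ≥0 → ℝ) : Prop where
  monotone : Monotone u
  sublinear : Tendsto (fun r : ℝ≥0 => u r / (r : ℝ)) atTop (𝓝 0)

section AM

variable {X : Type u} [ExtendedMetricSpace X] {Y : Type v} [ExtendedMetricSpace Y]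

/-- `x` and `y` are separated by `u` at the point at infinity, with respect to the origin `q`:
`d(x, y) > u(d(x, q) + d(q, y))` if both are finite; moreover every finite point is separated from
the point at infinity. -/
def Separated (u : ℝ≥0 → ℝ) (q : FinPt X) (x y : X) : Prop :=
  (x ≠ infPt ∧ y ≠ infPt ∧
    u ((xdist x q.1).toNNReal + (xdist q.1 y).toNNReal) < (xdist x y).toReal) ∨
  (x ≠ infPt ∧ y = infPt) ∨ (x = infPt ∧ y ≠ infPt)

/-- The four points are pairwise separated by `u` at infinity. -/
def PairwiseSeparated (u : ℝ≥0 → ℝ) (q : FinPt X) (x y z w : X) : Prop :=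
  Separated u q x y ∧ Separated u q x z ∧ Separated u q x w ∧
  Separated u q y z ∧ Separated u q y w ∧ Separated u q z w

/-- `f : (X, q, *_X) → (Y, q', *_Y)` is an asymptotic-Möbius map at infinity: a map of doubly
pointed spaces, for which there are an admissible gauge `u` and a homeomorphism `η` of `[0, ∞)` such
that `[f x, f y, f z, f w] < η [x, y, z, w]` for every cross ratio `[x, y, z, w]` of points that are
pairwise separated by `u`. -/
structure IsAMMap (f : X → Y) (q : FinPt X) (q' : FinPt Y) : Prop where
  map_origin : f q.1 = q'.1
  map_infPt : f infPt = infPt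
  cross_ratio : ∃ (u : ℝ≥0 → ℝ) (η : ℝ≥0 ≃ₜ ℝ≥0), IsAdmissibleGauge u ∧
    ∀ x y z w : X, PairwiseSeparated u q x y z w → x ≠ w → y ≠ z →
      crossRatio (f x) (f y) (f z) (f w) < η (crossRatio x y z w).toNNReal

/-- Regular AM-maps at infinity: `f` is continuous at the point at infinity, and preimages of small
neighbourhoods of the point at infinity are contained in small neighbourhoods of it. -/
structure IsRegularAMMap (f : X → Y) (q : FinPt X) (q' : FinPt Y) : Prop
    extends IsAMMap f q q' where
  continuousAt : @ContinuousAt X Y (extendedMetricTopology X) (extendedMetricTopology Y) f infPt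
  preimage_subset : ∀ V ∈ @nhds X (extendedMetricTopology X) infPt,
    ∃ U ∈ @nhds Y (extendedMetricTopology Y) infPt, f ⁻¹' U ⊆ V

/-- `(X, q, *_X)` is asymptotically chained: for some admissible gauge `v`, any finite points `x`
and `y` are joined by a finite chain of finite points with steps shorter than `v(|x| + |y|)`. -/
def AsymptoticallyChained (q : FinPt X) : Prop :=
  ∃ v : ℝ≥0 → ℝ, IsAdmissibleGauge v ∧ ∀ x y : FinPt X,
    ∃ (k : ℕ) (c : ℕ → FinPt X), c 0 = x ∧ c k = y ∧
      ∀ i < k, dist (c i) (c (i + 1)) < v (nndist q x + nndist q y)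

end AM

/-! ### Asymptotic cones -/

section Cone

variable {M : Type u} [MetricSpace M]

/-- The sequences that represent the finite points of the asymptotic cone of `M` with origin `q`,
ultrafilter `ω` and scales `r n → ∞`: those with `d(q, x n) / r n` bounded `ω`-almost surely. -/
def ConeSeq (q : M) (ω : Ultrafilter ℕ) (r : ℕ → ℝ) (_hr : Tendsto r ω atTop) : Type u :=
  {x : ℕ → M // ∃ C : ℝ, ∀ᶠ n in (ω : Filter ℕ), dist q (x n) / r n ≤ C}

variable {q : M} {ω : Ultrafilter ℕ} {r : ℕ → ℝ} {hr : Tendsto r ω atTop}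

/-- The distance `lim_ω d(x n, y n) / r n`. -/
noncomputable def coneDist (x y : ConeSeq q ω r hr) : ℝ :=
  limUnder (ω : Filter ℕ) (fun n => dist (x.1 n) (y.1 n) / r n)

/-- The limit that defines `coneDist` exists. -/
theorem tendsto_coneDist (x y : ConeSeq q ω r hr) :
    Tendsto (fun n => dist (x.1 n) (y.1 n) / r n) ω (𝓝 (coneDist x y)) := by
  obtain ⟨C, hC⟩ := x.2
  obtain ⟨D, hD⟩ := y.2
  have hmem : ∀ᶠ n in (ω : Filter ℕ), dist (x.1 n) (y.1 n) / r n ∈ Icc 0 (C + D) := by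
    filter_upwards [hC, hD, hr.eventually_gt_atTop 0] with n h1 h2 h3
    refine ⟨by positivity, ?_⟩
    calc dist (x.1 n) (y.1 n) / r n ≤ (dist q (x.1 n) + dist q (y.1 n)) / r n := by
          gcongr
          exact dist_triangle_left _ _ _
      _ = dist q (x.1 n) / r n + dist q (y.1 n) / r n := add_div _ _ _
      _ ≤ C + D := add_le_add h1 h2
  obtain ⟨l, -, hl⟩ := isCompact_Icc.ultrafilter_le_nhds
    (ω.map (fun n => dist (x.1 n) (y.1 n) / r n))
    (by rw [le_principal_iff]; exact hmem)
  exact tendsto_nhds_limUnder ⟨l, hl⟩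

/-- `coneDist` is a pseudometric. -/
noncomputable instance ConeSeq.pseudoMetricSpace : PseudoMetricSpace (ConeSeq q ω r hr) where
  dist := coneDist
  dist_self x := by
    refine tendsto_nhds_unique (tendsto_coneDist x x) ?_
    simp
  dist_comm x y := by
    refine tendsto_nhds_unique (tendsto_coneDist x y) ?_
    simpa only [dist_comm] using tendsto_coneDist y x
  dist_triangle x y z := by
    refine le_of_tendsto_of_tendsto (tendsto_coneDist x z)
      ((tendsto_coneDist x y).add (tendsto_coneDist y z)) ?_
    filter_upwards [hr.eventually_gt_atTop 0] with n h
    rw [← add_div]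
    gcongr
    exact dist_triangle _ _ _

end Cone

/-- The (metric space of finite points of the) asymptotic cone of `X` with origin `q`, ultrafilter
`ω` and scales `r n`: sequences in `X`, two of them being identified if their distance
`lim_ω d(x n, y n) / r n` vanishes. -/
abbrev AsymptoticCone {X : Type u} [ExtendedMetricSpace X] (q : FinPt X) (ω : Ultrafilter ℕ)
    (r : ℕ → ℝ) (hr : Tendsto r ω atTop) : Type u :=
  SeparationQuotient (ConeSeq q ω r hr)

/-! ### CAT(0) spaces -/

/-- `c`, restricted to `[0, d(x, y)]`, is a geodesic from `x` to `y`. -/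
structure IsGeodesicFromTo {M : Type u} [MetricSpace M] (c : ℝ → M) (x y : M) : Prop where
  start : c 0 = x
  finish : c (dist x y) = y
  isometry : ∀ s ∈ Icc 0 (dist x y), ∀ t ∈ Icc 0 (dist x y), dist (c s) (c t) = |s - t|

/-- CAT(0) spaces: geodesic metric spaces whose geodesic triangles are not thicker than their
comparison triangles in the Euclidean plane. (Two sides of a triangle have a common vertex, which
is called `x` here.) -/
structure IsCAT0 (M : Type u) [MetricSpace M] : Prop where
  geodesic : ∀ x y : M, ∃ c : ℝ → M, IsGeodesicFromTo c x y
  comparison : ∀ (x y z : M) (c c' : ℝ → M), IsGeodesicFromTo c x y → IsGeodesicFromTo c' x z →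
    ∀ x₀ y₀ z₀ : EuclideanSpace ℝ (Fin 2),
      dist x₀ y₀ = dist x y → dist x₀ z₀ = dist x z → dist y₀ z₀ = dist y z →
      ∀ s ∈ Icc 0 (dist x y), ∀ t ∈ Icc 0 (dist x z),
        ∀ p₀ ∈ segment ℝ x₀ y₀, ∀ q₀ ∈ segment ℝ x₀ z₀, dist x₀ p₀ = s → dist x₀ q₀ = t →
          dist (c s) (c' t) ≤ dist p₀ q₀

/-- All asymptotic cones of `X` are CAT(0) spaces. -/
def AllAsymptoticConesCAT0 (X : Type u) [ExtendedMetricSpace X] : Prop :=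
  ∀ (q : FinPt X) (ω : Ultrafilter ℕ), (ω : Filter ℕ) ≤ cofinite →
    ∀ (r : ℕ → ℝ) (hr : Tendsto r ω atTop), IsCAT0 (AsymptoticCone q ω r hr)

/-! ### Dimensions -/

/-- Every finite open cover of `T` has an open refinement that covers `T` and such that every point
lies in at most `n + 1` of its members. -/
def CoveringDimLE (T : Type u) [TopologicalSpace T] (n : ℕ) : Prop :=
  ∀ 𝒱 : Set (Set T), 𝒱.Finite → (∀ V ∈ 𝒱, IsOpen V) → ⋃₀ 𝒱 = univ →
    ∃ 𝒰 : Set (Set T), (∀ U ∈ 𝒰, IsOpen U) ∧ ⋃₀ 𝒰 = univ ∧ (∀ U ∈ 𝒰, ∃ V ∈ 𝒱, U ⊆ V) ∧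
      ∀ x : T, {U ∈ 𝒰 | x ∈ U}.encard ≤ n + 1

/-- The covering dimension: the least `n` as above, or `∞` if there is none. -/
noncomputable def coveringDim (T : Type u) [TopologicalSpace T] : ℕ∞ :=
  ⨅ (n : ℕ) (_ : CoveringDimLE T n), (n : ℕ∞)

/-- The geometric dimension: the supremum of the covering dimensions of the compact subsets. -/
noncomputable def geomDim (M : Type u) [MetricSpace M] : ℕ∞ :=
  ⨆ (K : Set M) (_ : IsCompact K), coveringDim K

/-- The telescopic dimension: the supremum of the geometric dimensions of all asymptotic cones, so
it is at most `n` if and only if every asymptotic cone has geometric dimension at most `n`. -/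
noncomputable def teleDim (X : Type u) [ExtendedMetricSpace X] : ℕ∞ :=
  ⨆ (q : FinPt X) (ω : Ultrafilter ℕ) (_ : (ω : Filter ℕ) ≤ cofinite)
    (r : ℕ → ℝ) (hr : Tendsto r ω atTop), geomDim (AsymptoticCone q ω r hr)

/-! ### Homeomorphisms of the half-line -/

/-! Every nontrivial asymptotic cone of `X` maps continuously and injectively into an asymptotic
cone of `Y`, for the same ultrafilter but other scales. Putting `w = infPt` in the cross-ratio
inequality turns the AM condition into a quasi-symmetry inequality for separated finite points
(`exists_dist_finMap_le`). Sequences representing distinct cone points are a distance of order `r n`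
apart, while the gauge is `o(r n)`, so they are eventually separated
(`ConeSeq.eventually_gauge_lt_dist`).

Fix a cone point `p` other than the class of `o` and rescale `Y` by `s n = |f (p n)|`. Properness
gives `s n → ∞`, quasi-symmetry bounds `|f (x n)| / s n`, and the limit map is quasi-symmetric and
nonconstant, hence injective and continuous (`exists_continuous_injective_cone`). On compact sets it
is an embedding, so the dimension cannot drop (`geomDim_le_of_injective`). -/

theorem NNReal.homeomorph_zero (η : ℝ≥0 ≃ₜ ℝ≥0) : η 0 = 0 := by
  rcases η.continuous.strictMono_of_inj η.injective with h | h
  · obtain ⟨t, ht⟩ := η.surjective 0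
    exact le_antisymm ((h.monotone zero_le).trans_eq ht) zero_le
  -- A decreasing `η` would be bounded by `η 0`, against surjectivity.
  · obtain ⟨t, ht⟩ := η.surjective (η 0 + 1)
    have h1 : η t ≤ η 0 := h.antitone zero_le
    rw [ht] at h1
    exact absurd h1 (not_le.2 (lt_add_one _))

/-! ### Dimensions under topological embeddings -/

theorem CoveringDimLE.of_homeomorph {S : Type u} {T : Type v} [TopologicalSpace S]
    [TopologicalSpace T] (e : S ≃ₜ T) {n : ℕ} (h : CoveringDimLE T n) : CoveringDimLE S n := by
  intro 𝒱 hfin hopen hcov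
  obtain ⟨𝒰, h1, h2, h3, h4⟩ := h ((fun V => e.symm ⁻¹' V) '' 𝒱) (hfin.image _)
    (by rintro _ ⟨V, hV, rfl⟩; exact (hopen V hV).preimage e.symm.continuous)
    (by
      refine eq_univ_of_forall fun y => ?_
      obtain ⟨V, hV, hy⟩ := mem_sUnion.1 (hcov ▸ mem_univ (e.symm y))
      exact ⟨_, ⟨V, hV, rfl⟩, hy⟩)
  refine ⟨(fun U => e ⁻¹' U) '' 𝒰, ?_, ?_, ?_, fun x => ?_⟩
  · rintro _ ⟨U, hU, rfl⟩
    exact (h1 U hU).preimage e.continuous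
  · refine eq_univ_of_forall fun x => ?_
    obtain ⟨U, hU, hx⟩ := mem_sUnion.1 (h2 ▸ mem_univ (e x))
    exact ⟨_, ⟨U, hU, rfl⟩, hx⟩
  · rintro _ ⟨U, hU, rfl⟩
    obtain ⟨_, ⟨V, hV, rfl⟩, hUV⟩ := h3 U hU
    refine ⟨V, hV, fun x hx => ?_⟩
    simpa using hUV hx
  · refine le_trans (encard_le_encard ?_) ((encard_image_le (fun U => e ⁻¹' U) _).trans (h4 (e x)))
    rintro _ ⟨⟨U, hU, rfl⟩, hx⟩
    exact ⟨U, ⟨hU, hx⟩, rfl⟩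

theorem coveringDim_le_of_homeomorph {S : Type u} {T : Type v} [TopologicalSpace S]
    [TopologicalSpace T] (e : S ≃ₜ T) : coveringDim S ≤ coveringDim T :=
  le_iInf₂ fun n hn => iInf₂_le n (hn.of_homeomorph e)

theorem coveringDim_eq_zero_of_subsingleton (T : Type u) [TopologicalSpace T] [Subsingleton T] :
    coveringDim T = 0 := by
  refine le_antisymm (iInf₂_le 0 fun 𝒱 _ hopen hcov => ?_) zero_le
  -- Not simply `{univ}`: if `T` is empty, `𝒱` may be empty too.
  refine ⟨{U | U ∈ 𝒱 ∧ U = univ}, fun U hU => hopen U hU.1, ?_,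
    fun U hU => ⟨U, hU.1, subset_rfl⟩, fun x => ?_⟩
  · refine eq_univ_of_forall fun x => ?_
    obtain ⟨V, hV, hx⟩ := mem_sUnion.1 (hcov ▸ mem_univ x)
    exact ⟨V, ⟨hV, eq_univ_of_forall fun y => Subsingleton.elim x y ▸ hx⟩, hx⟩
  · refine (encard_le_encard (t := {univ}) ?_).trans (by simp)
    exact fun U hU => hU.1.2

theorem geomDim_eq_zero_of_subsingleton (M : Type u) [MetricSpace M] [Subsingleton M] :
    geomDim M = 0 := by
  simp [geomDim, coveringDim_eq_zero_of_subsingleton]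

/-- Only compact subsets count, and a continuous injection of a compact space into a Hausdorff space
is a homeomorphism onto its image. -/
theorem geomDim_le_of_injective {M : Type u} {N : Type v} [MetricSpace M] [MetricSpace N]
    (F : M → N) (hc : Continuous F) (hi : Function.Injective F) : geomDim M ≤ geomDim N := by
  refine iSup₂_le fun K hK => ?_
  have : CompactSpace K := isCompact_iff_compactSpace.1 hK
  let e : K ≃ₜ (F '' K) := Continuous.homeoOfEquivCompactToT2
    (f := Equiv.Set.image F K hi)
    ((hc.comp continuous_subtype_val).subtype_mk _)
  exact (coveringDim_le_of_homeomorph e).trans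
    (le_iSup₂_of_le (F '' K) (hK.image hc) le_rfl)

/-! ### Quasi-symmetric maps -/

section QuasiSymmetric

variable {M : Type u} {N : Type v} [MetricSpace M] [MetricSpace N] {F : M → N} {η : ℝ≥0 ≃ₜ ℝ≥0}

/-- The defining inequality of an `η`-quasi-symmetric map, for distinct points. -/
def QuasiSymmetric (η : ℝ≥0 ≃ₜ ℝ≥0) (F : M → N) : Prop :=
  ∀ x y z : M, x ≠ y → x ≠ z → y ≠ z →
    dist (F x) (F z) ≤ η (nndist x z / nndist y z) * dist (F y) (F z)

/-- If two distinct points had the same image, the inequality with these two on its right-hand side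
would collapse every other point onto that image. -/
theorem QuasiSymmetric.injective (hF : QuasiSymmetric η F) {p q : M} (hpq : F p ≠ F q) :
    Function.Injective F := by
  intro x y hxy
  by_contra hne
  have key : ∀ z, F z = F y := by
    intro z
    by_cases hzx : z = x
    · rw [hzx, hxy]
    by_cases hzy : z = y
    · rw [hzy]
    have h := hF z x y hzx hzy hne
    rw [hxy, dist_self, mul_zero] at h
    exact dist_le_zero.1 h
  exact hpq ((key p).trans (key q).symm)

/-- With `y ≠ z` fixed, the right-hand side of the inequality tends to `0` as `x → z`, because `η 0
= 0`. -/
theorem QuasiSymmetric.continuous [Nontrivial M] (hF : QuasiSymmetric η F) : Continuous F := by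
  refine continuous_iff_continuousAt.2 fun z => ?_
  obtain ⟨y, hyz⟩ := exists_ne z
  have hlim : Tendsto (fun x => (η (nndist x z / nndist y z) : ℝ) * dist (F y) (F z)) (𝓝 z)
      (𝓝 0) := by
    have h : ContinuousAt
        (fun x => (η (nndist x z / nndist y z) : ℝ) * dist (F y) (F z)) z := by
      refine ContinuousAt.mul (NNReal.continuous_coe.continuousAt.comp
        (η.continuous.continuousAt.comp ?_)) continuousAt_const
      exact ContinuousAt.div_const (by fun_prop) _
    simpa [ContinuousAt, NNReal.homeomorph_zero] using h
  rw [ContinuousAt, tendsto_iff_dist_tendsto_zero]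
  refine squeeze_zero' (Eventually.of_forall fun _ => dist_nonneg) ?_ hlim
  filter_upwards [isOpen_ne.mem_nhds hyz.symm] with x hx
  by_cases hxz : x = z
  · subst hxz
    simp only [dist_self]
    positivity
  · exact hF x y z hx hxz hyz

end QuasiSymmetric

/-! ### Neighbourhoods of the point at infinity -/

section Neighbourhoods

variable {X : Type u} [ExtendedMetricSpace X]

theorem FinPt.xdist_eq_nndist (x y : FinPt X) : xdist x.1 y.1 = nndist x y := by
  rw [← ENNReal.coe_toNNReal (xdist_ne_top _ _ x.2 y.2)]
  rfl

theorem setOf_lt_xdist_mem_nhds_infPt (x : FinPt X) {r : ℝ≥0} (hr : 0 < r) :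
    {y : X | (r : ℝ≥0∞) < xdist x.1 y} ∈ @nhds X (extendedMetricTopology X) infPt := by
  let _ : TopologicalSpace X := extendedMetricTopology X
  refine IsOpen.mem_nhds (TopologicalSpace.isOpen_generateFrom_of_mem (Or.inr ⟨x, r, hr, rfl⟩)) ?_
  simp [xdist_infPt x.1 x.2]

/-- No generating ball contains `infPt`, and the complement of a ball about `x` contains the
complement of a ball about `o` whose radius is larger by `d(o, x)`. -/
theorem exists_setOf_lt_xdist_subset (o : FinPt X) {V : Set X}
    (hV : V ∈ @nhds X (extendedMetricTopology X) infPt) :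
    ∃ R : ℝ≥0, {y : X | (R : ℝ≥0∞) < xdist o.1 y} ⊆ V := by
  let l : Filter X := ⨅ R : ℝ≥0, 𝓟 {y : X | (R : ℝ≥0∞) < xdist o.1 y}
  have hl : l.HasBasis (fun _ : ℝ≥0 => True) fun R => {y : X | (R : ℝ≥0∞) < xdist o.1 y} := by
    refine hasBasis_iInf_principal ?_
    intro R S
    refine ⟨max R S, fun y hy => ?_, fun y hy => ?_⟩
    · exact lt_of_le_of_lt (ENNReal.coe_le_coe.2 (le_max_left R S)) hy
    · exact lt_of_le_of_lt (ENNReal.coe_le_coe.2 (le_max_right R S)) hy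
  have hle : l ≤ @nhds X (extendedMetricTopology X) infPt := by
    rw [TopologicalSpace.nhds_generateFrom]
    refine le_iInf₂ fun s hs => ?_
    rw [le_principal_iff]
    obtain ⟨hinf, ⟨x, r, -, rfl⟩ | ⟨x, r, -, rfl⟩⟩ := hs
    · simp [xdist_infPt x.1 x.2] at hinf
    · refine hl.mem_iff.2 ⟨r + nndist o x, trivial, fun y hy => ?_⟩
      by_cases hy' : y = infPt
      · simp [hy', xdist_infPt x.1 x.2]
      have h := lt_of_lt_of_le (show ((r + nndist o x : ℝ≥0) : ℝ≥0∞) < xdist o.1 y from hy)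
        (xdist_triangle o.1 x.1 y o.2 x.2 hy')
      rw [FinPt.xdist_eq_nndist, ENNReal.coe_add, add_comm] at h
      exact lt_of_add_lt_add_left h
  obtain ⟨R, -, hR⟩ := hl.mem_iff.1 (hle hV)
  exact ⟨R, hR⟩

theorem crossRatio_infPt {a b c : FinPt X} (hac : a ≠ c) (hbc : b ≠ c) :
    crossRatio a.1 b.1 c.1 infPt = ((nndist a c / nndist b c : ℝ≥0) : ℝ≥0∞) := by
  have h1 : a.1 ≠ c.1 := fun h => hac (Subtype.ext h)
  have h2 : b.1 ≠ c.1 := fun h => hbc (Subtype.ext h)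
  rw [ENNReal.coe_div (by simpa using hbc)]
  simp [crossRatio, crossFactor, h1, h2, a.2, b.2, c.2, FinPt.xdist_eq_nndist]

end Neighbourhoods

/-! ### Regular AM-maps on finite points -/

section AMMap

variable {X : Type u} [ExtendedMetricSpace X] {Y : Type v} [ExtendedMetricSpace Y]
  {f : X → Y} {o : FinPt X} {o' : FinPt Y}

theorem IsRegularAMMap.map_ne_infPt (hf : IsRegularAMMap f o o') {x : X} (hx : x ≠ infPt) :
    f x ≠ infPt := by
  intro hfx
  -- A finite point sent to `infPt` would lie in every neighbourhood of infinity, even in one that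
  -- excludes it by its radius.
  obtain ⟨U, hU, hUV⟩ := hf.preimage_subset _
    (setOf_lt_xdist_mem_nhds_infPt o (r := (xdist o.1 x).toNNReal + 1) (by positivity))
  have hmem : x ∈ f ⁻¹' U := by
    rw [mem_preimage, hfx]
    exact @mem_of_mem_nhds Y (extendedMetricTopology Y) _ _ hU
  have h : (((xdist o.1 x).toNNReal + 1 : ℝ≥0) : ℝ≥0∞) < xdist o.1 x := hUV hmem
  rw [ENNReal.coe_add, ENNReal.coe_toNNReal (xdist_ne_top _ _ o.2 hx)] at h
  exact absurd h (not_lt.2 le_self_add)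

/-- The restriction of a regular AM-map to the finite points. -/
def IsRegularAMMap.finMap (hf : IsRegularAMMap f o o') (x : FinPt X) : FinPt Y :=
  ⟨f x.1, hf.map_ne_infPt x.2⟩

theorem IsRegularAMMap.finMap_origin (hf : IsRegularAMMap f o o') : hf.finMap o = o' :=
  Subtype.ext hf.map_origin

theorem IsRegularAMMap.exists_lt_dist_finMap (hf : IsRegularAMMap f o o') (S : ℝ) :
    ∃ R : ℝ, ∀ x : FinPt X, R < dist o x → S < dist o' (hf.finMap x) := by
  have hc : Tendsto f (@nhds X (extendedMetricTopology X) infPt)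
      (@nhds Y (extendedMetricTopology Y) (f infPt)) := hf.continuousAt
  rw [hf.map_infPt] at hc
  have hmem := hc (setOf_lt_xdist_mem_nhds_infPt o' (r := S.toNNReal + 1) (by positivity))
  obtain ⟨R, hR⟩ := exists_setOf_lt_xdist_subset o hmem
  refine ⟨R, fun x hx => ?_⟩
  have h1 : (R : ℝ≥0∞) < xdist o.1 x.1 := by
    rw [FinPt.xdist_eq_nndist, ENNReal.coe_lt_coe]
    exact_mod_cast hx
  have h2 : ((S.toNNReal + 1 : ℝ≥0) : ℝ≥0∞) < xdist o'.1 (hf.finMap x).1 := hR h1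
  rw [FinPt.xdist_eq_nndist, ENNReal.coe_lt_coe, ← NNReal.coe_lt_coe] at h2
  push_cast at h2
  linarith [Real.le_coe_toNNReal S]

theorem separated_coe {u : ℝ≥0 → ℝ} {a b : FinPt X}
    (h : u (nndist o a + nndist o b) < dist a b) : Separated u o a.1 b.1 := by
  refine Or.inl ⟨a.2, b.2, ?_⟩
  rw [xdist_comm a.1 o.1]
  exact h

/-- An AM-map restricts to a map of the finite points that is quasi-symmetric up to a gauge. -/
theorem IsRegularAMMap.exists_dist_finMap_le (hf : IsRegularAMMap f o o') :
    ∃ (u : ℝ≥0 → ℝ) (η : ℝ≥0 ≃ₜ ℝ≥0), IsAdmissibleGauge u ∧ ∀ a b c : FinPt X,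
      a ≠ c → b ≠ c → u (nndist o a + nndist o b) < dist a b →
      u (nndist o a + nndist o c) < dist a c → u (nndist o b + nndist o c) < dist b c →
      dist (hf.finMap a) (hf.finMap c) ≤
        η (nndist a c / nndist b c) * dist (hf.finMap b) (hf.finMap c) := by
  obtain ⟨u, η, hu, H⟩ := hf.cross_ratio
  refine ⟨u, η, hu, fun a b c hac hbc h1 h2 h3 => ?_⟩
  have h := H a.1 b.1 c.1 infPt
    ⟨separated_coe h1, separated_coe h2, Or.inr (Or.inl ⟨a.2, rfl⟩), separated_coe h3,
      Or.inr (Or.inl ⟨b.2, rfl⟩), Or.inr (Or.inl ⟨c.2, rfl⟩)⟩ a.2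
    (fun h => hbc (Subtype.ext h))
  rw [crossRatio_infPt hac hbc, ENNReal.toNNReal_coe, hf.map_infPt] at h
  change crossRatio (hf.finMap a).1 (hf.finMap b).1 (hf.finMap c).1 infPt < _ at h
  by_cases hac' : hf.finMap a = hf.finMap c
  · rw [hac', dist_self]
    positivity
  -- Otherwise the image cross ratio would be `∞`, yet it is below a finite value of `η`.
  have hbc' : hf.finMap b ≠ hf.finMap c := by
    intro hbc'
    have hne : (hf.finMap a).1 ≠ (hf.finMap c).1 := fun h => hac' (Subtype.ext h)
    simp [crossRatio, hbc', hne, (hf.finMap c).2] at h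
  rw [crossRatio_infPt hac' hbc', ENNReal.coe_lt_coe, ← NNReal.coe_lt_coe, NNReal.coe_div,
    coe_nndist, coe_nndist, div_lt_iff₀ (dist_pos.2 hbc')] at h
  exact h.le

end AMMap

/-! ### The induced map of asymptotic cones -/

theorem IsAdmissibleGauge.eventually_lt {u : ℝ≥0 → ℝ} (hu : IsAdmissibleGauge u)
    {l : Filter ℕ} {r : ℕ → ℝ} (hr : Tendsto r l atTop) {s : ℕ → ℝ≥0} {C : ℝ}
    (hs : ∀ᶠ n in l, s n / r n ≤ C) {δ : ℝ} (hδ : 0 < δ) : ∀ᶠ n in l, u (s n) / r n < δ := by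
  -- Monotonicity lets `D * r n` replace `s n`, which need not tend to infinity; this needs `D > 0`.
  obtain ⟨D, hD, hCD⟩ : ∃ D : ℝ≥0, 0 < D ∧ C ≤ D :=
    ⟨C.toNNReal + 1, by positivity, by push_cast; linarith [Real.le_coe_toNNReal C]⟩
  have hD' : (0 : ℝ) < D := hD
  have ht : Tendsto (fun n => D * (r n).toNNReal) l atTop :=
    (tendsto_real_toNNReal_atTop.comp hr).const_mul_atTop hD
  have h0 := (hu.sublinear.comp ht).eventually (gt_mem_nhds (div_pos hδ hD'))
  filter_upwards [hs, h0, hr.eventually_gt_atTop 0] with n h1 h2 h3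
  have hle : s n ≤ D * (r n).toNNReal := by
    rw [← NNReal.coe_le_coe, NNReal.coe_mul, Real.coe_toNNReal _ h3.le]
    exact ((div_le_iff₀ h3).1 h1).trans (by gcongr)
  simp only [Function.comp_apply, NNReal.coe_mul, Real.coe_toNNReal _ h3.le] at h2
  rw [div_lt_div_iff₀ (by positivity) hD'] at h2
  rw [div_lt_iff₀ h3]
  have h4 := hu.monotone hle
  nlinarith

section Cone

variable {M : Type u} {N : Type v} [MetricSpace M] [MetricSpace N]
  {q o : M} {ω : Ultrafilter ℕ} {r : ℕ → ℝ} {hr : Tendsto r ω atTop}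

/-- The constant sequences represent a point of every asymptotic cone. -/
def ConeSeq.const (o : M) : ConeSeq q ω r hr :=
  ⟨fun _ => o, dist q o, by
    filter_upwards [hr.eventually_ge_atTop 1] with n hn
    exact div_le_self dist_nonneg hn⟩

/-- The gauge is measured from `o`, the cone from `q`; the change of origin is harmless because the
constant sequence `o` is itself a cone point. -/
theorem ConeSeq.exists_dist_le (o : M) (x : ConeSeq q ω r hr) :
    ∃ C : ℝ, ∀ᶠ n in (ω : Filter ℕ), dist o (x.1 n) / r n ≤ C := by
  refine ⟨coneDist (ConeSeq.const o) x + 1, ?_⟩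
  filter_upwards [(tendsto_coneDist (ConeSeq.const o) x).eventually
    (gt_mem_nhds (lt_add_one _))] with n hn
  exact hn.le

theorem ConeSeq.eventually_gauge_lt_dist (o : M) {u : ℝ≥0 → ℝ} (hu : IsAdmissibleGauge u)
    {x y : ConeSeq q ω r hr} (hxy : 0 < coneDist x y) :
    ∀ᶠ n in (ω : Filter ℕ),
      u (nndist o (x.1 n) + nndist o (y.1 n)) < dist (x.1 n) (y.1 n) := by
  obtain ⟨C, hC⟩ := x.exists_dist_le o
  obtain ⟨D, hD⟩ := y.exists_dist_le o
  have hs : ∀ᶠ n in (ω : Filter ℕ),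
      ((nndist o (x.1 n) + nndist o (y.1 n) : ℝ≥0) : ℝ) / r n ≤ C + D := by
    filter_upwards [hC, hD] with n h1 h2
    rw [NNReal.coe_add, add_div]
    exact add_le_add h1 h2
  filter_upwards [hu.eventually_lt hr hs (half_pos hxy),
    (tendsto_coneDist x y).eventually (lt_mem_nhds (half_lt_self hxy)),
    hr.eventually_gt_atTop 0] with n h1 h2 h3
  exact (div_lt_div_iff_of_pos_right h3).1 (h1.trans h2)

theorem ConeSeq.eventually_ne {x y : ConeSeq q ω r hr} (hxy : 0 < coneDist x y) :
    ∀ᶠ n in (ω : Filter ℕ), x.1 n ≠ y.1 n := by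
  filter_upwards [(tendsto_coneDist x y).eventually (lt_mem_nhds hxy)] with n hn h
  simp [h] at hn

theorem ConeSeq.tendsto_nndist_div (x y z : ConeSeq q ω r hr) (hyz : 0 < coneDist y z) :
    Tendsto (fun n => nndist (x.1 n) (z.1 n) / nndist (y.1 n) (z.1 n)) ω
      (𝓝 (nndist x z / nndist y z)) := by
  rw [← NNReal.tendsto_coe]
  push_cast
  refine ((tendsto_coneDist x z).div (tendsto_coneDist y z) hyz.ne').congr' ?_
  filter_upwards [hr.eventually_gt_atTop 0] with n hn
  exact div_div_div_cancel_right₀ hn.ne' _ _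

/-- A map that is quasi-symmetric up to a gauge and proper towards infinity induces an injective
continuous map of any nontrivial asymptotic cone into an asymptotic cone of the target. -/
theorem exists_continuous_injective_cone {g : M → N} {u : ℝ≥0 → ℝ} {η : ℝ≥0 ≃ₜ ℝ≥0}
    (hu : IsAdmissibleGauge u)
    (hg : ∀ a b c : M, a ≠ c → b ≠ c → u (nndist o a + nndist o b) < dist a b →
      u (nndist o a + nndist o c) < dist a c → u (nndist o b + nndist o c) < dist b c →
      dist (g a) (g c) ≤ η (nndist a c / nndist b c) * dist (g b) (g c))
    (hproper : ∀ S : ℝ, ∃ R : ℝ, ∀ x : M, R < dist o x → S < dist (g o) (g x))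
    [Nontrivial (SeparationQuotient (ConeSeq q ω r hr))] :
    ∃ (s : ℕ → ℝ) (hs : Tendsto s ω atTop)
      (F : SeparationQuotient (ConeSeq q ω r hr) → SeparationQuotient (ConeSeq (g o) ω s hs)),
      Continuous F ∧ Function.Injective F := by
  classical
  let O : SeparationQuotient (ConeSeq q ω r hr) := SeparationQuotient.mk (ConeSeq.const o)
  -- Representatives are chosen once and for all: `g` is not controlled on pairs at sublinear
  -- distance, so it need not respect the identification. Taking the constant sequence for `O` sends
  -- `O` to the origin `g o`.
  obtain ⟨rep, hrep, hrepO⟩ : ∃ rep : SeparationQuotient (ConeSeq q ω r hr) → ConeSeq q ω r hr,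
      (∀ x, SeparationQuotient.mk (rep x) = x) ∧ rep O = ConeSeq.const o := by
    refine ⟨Function.update (Function.surjInv SeparationQuotient.surjective_mk) O
      (ConeSeq.const o), fun x => ?_, by simp⟩
    by_cases hx : x = O
    · simp [hx, O]
    · rw [Function.update_of_ne hx]
      exact Function.surjInv_eq _ x
  have hdist : ∀ x y, coneDist (rep x) (rep y) = dist x y := by
    intro x y
    conv_rhs => rw [← hrep x, ← hrep y, SeparationQuotient.dist_mk]
    rfl
  have hnndist : ∀ x y, nndist (rep x) (rep y) = nndist x y := fun x y =>
    NNReal.eq (hdist x y)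
  have hpos : ∀ {x y}, x ≠ y → 0 < coneDist (rep x) (rep y) := by
    intro x y hxy
    rw [hdist]
    exact dist_pos.2 hxy
  have hineq : ∀ x y z, x ≠ y → x ≠ z → y ≠ z → ∀ᶠ n in (ω : Filter ℕ),
      dist (g ((rep x).1 n)) (g ((rep z).1 n)) ≤
        η (nndist ((rep x).1 n) ((rep z).1 n) / nndist ((rep y).1 n) ((rep z).1 n)) *
          dist (g ((rep y).1 n)) (g ((rep z).1 n)) := by
    intro x y z hxy hxz hyz
    filter_upwards [ConeSeq.eventually_ne (hpos hxz), ConeSeq.eventually_ne (hpos hyz),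
      ConeSeq.eventually_gauge_lt_dist o hu (hpos hxy),
      ConeSeq.eventually_gauge_lt_dist o hu (hpos hxz),
      ConeSeq.eventually_gauge_lt_dist o hu (hpos hyz)] with n h1 h2 h3 h4 h5
    exact hg _ _ _ h1 h2 h3 h4 h5
  have hη : ∀ x y z, y ≠ z → Tendsto (fun n => (η (nndist ((rep x).1 n) ((rep z).1 n) /
      nndist ((rep y).1 n) ((rep z).1 n)) : ℝ)) ω (𝓝 (η (nndist x z / nndist y z))) := by
    intro x y z hyz
    rw [NNReal.tendsto_coe, ← hnndist x z, ← hnndist y z]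
    exact (η.continuous.tendsto _).comp (ConeSeq.tendsto_nndist_div _ _ _ (hpos hyz))
  have hO : ∀ n, (rep O).1 n = o := fun n => by rw [hrepO]; rfl
  obtain ⟨p, hp⟩ := exists_ne O
  let s : ℕ → ℝ := fun n => dist (g o) (g ((rep p).1 n))
  have hs : Tendsto s ω atTop := by
    refine tendsto_atTop.2 fun S => ?_
    obtain ⟨R, hR⟩ := hproper S
    have hd : Tendsto (fun n => dist ((rep O).1 n) ((rep p).1 n) / r n * r n) ω atTop :=
      (tendsto_coneDist (rep O) (rep p)).pos_mul_atTop (hpos hp.symm) hr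
    filter_upwards [hd.eventually_gt_atTop R, hr.eventually_gt_atTop 0] with n h1 h2
    rw [div_mul_cancel₀ _ h2.ne', hO] at h1
    exact (hR _ h1).le
  have hbdd : ∀ x, ∃ C : ℝ, ∀ᶠ n in (ω : Filter ℕ),
      dist (g o) (g ((rep x).1 n)) / s n ≤ C := by
    intro x
    -- The inequality needs three distinct points, so `O` and `p` are treated apart.
    by_cases hxO : x = O
    · refine ⟨0, Eventually.of_forall fun n => ?_⟩
      rw [hxO, hO, dist_self, zero_div]
    by_cases hxp : x = p
    · refine ⟨1, Eventually.of_forall fun n => ?_⟩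
      rw [hxp]
      exact div_self_le_one _
    refine ⟨η (nndist x O / nndist p O) + 1, ?_⟩
    filter_upwards [hineq x p O hxp hxO hp, (hη x p O hp).eventually
      (gt_mem_nhds (lt_add_one _)), hs.eventually_gt_atTop 0] with n h1 h2 h3
    rw [div_le_iff₀ h3]
    rw [hO, dist_comm _ (g o), dist_comm _ (g o)] at h1
    rw [hO] at h2
    exact h1.trans (mul_le_mul_of_nonneg_right h2.le h3.le)
  let G : SeparationQuotient (ConeSeq q ω r hr) → ConeSeq (g o) ω s hs :=
    fun x => ⟨fun n => g ((rep x).1 n), hbdd x⟩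
  let F : SeparationQuotient (ConeSeq q ω r hr) → SeparationQuotient (ConeSeq (g o) ω s hs) :=
    fun x => SeparationQuotient.mk (G x)
  have hFdist : ∀ x y, dist (F x) (F y) = coneDist (G x) (G y) := fun x y =>
    SeparationQuotient.dist_mk _ _
  have hF : QuasiSymmetric η F := by
    intro x y z hxy hxz hyz
    rw [hFdist, hFdist]
    refine le_of_tendsto_of_tendsto (tendsto_coneDist (G x) (G z))
      ((hη x y z hyz).mul (tendsto_coneDist (G y) (G z))) ?_
    filter_upwards [hineq x y z hxy hxz hyz, hs.eventually_gt_atTop 0] with n h1 h2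
    rw [← mul_div_assoc]
    exact div_le_div_of_nonneg_right h1 h2.le
  -- The scales `s` normalise this distance to `1`, which rules out a constant limit map.
  have hne : F O ≠ F p := by
    have h1 : dist (F O) (F p) = 1 := by
      rw [hFdist]
      refine tendsto_nhds_unique (tendsto_coneDist (G O) (G p)) (tendsto_const_nhds.congr' ?_)
      filter_upwards [hs.eventually_gt_atTop 0] with n hn
      have : (G O).1 n = g o := congrArg g (hO n)
      rw [this]
      exact (div_self hn.ne').symm
    intro h
    rw [h, dist_self] at h1
    exact zero_ne_one h1
  exact ⟨s, hs, F, hF.continuous, hF.injective hne⟩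

end Cone

theorem mainTheorem3 {X : Type u} {Y : Type v} [ExtendedMetricSpace X] [ExtendedMetricSpace Y]
    (o : FinPt X) (o' : FinPt Y)
    (hchain : AsymptoticallyChained o)
    (hX : AllAsymptoticConesCAT0 X) (hY : AllAsymptoticConesCAT0 Y)
    (f : X → Y) (hf : IsRegularAMMap f o o') :
    teleDim X ≤ teleDim Y := by
  refine iSup_le fun q => iSup_le fun ω => iSup_le fun hω => iSup_le fun r => iSup_le fun hr => ?_
  -- A one-point cone offers no `p` to define the new scales, but it has dimension `0`.
  rcases subsingleton_or_nontrivial (AsymptoticCone q ω r hr) with h | h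
  · rw [geomDim_eq_zero_of_subsingleton]
    exact zero_le
  · obtain ⟨u, η, hu, hg⟩ := hf.exists_dist_finMap_le
    obtain ⟨s, hs, F, hc, hi⟩ := exists_continuous_injective_cone (q := q) (hr := hr) hu hg
      (by rw [hf.finMap_origin]; exact hf.exists_lt_dist_finMap)
    exact (geomDim_le_of_injective F hc hi).trans
      (le_iSup_of_le (hf.finMap o) (le_iSup_of_le ω (le_iSup_of_le hω
        (le_iSup_of_le s (le_iSup_of_le hs le_rfl)))))
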